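/- All graphs are finite, simple and undirected. A connected graph $X$ of diameter $d$ is \emph{distance-regular} if for every $0\le i\le d$ there are constants $a_i,b_i,c_i$ such that for all vertices $v,w$ at distance $i$, the vertex $w$ has exactly $a_i$, $b_i$, $c_i$ neighbours at distance $i$, $i+1$, $i-1$ from $v$, respectively. For $i\ge 1$, the \emph{distance-$i$ graph} $X_i$ has the same vertices as $X$, two of them being adjacent if and only if their distance in $X$ is $i$. A distance-regular graph $X$ of diameter $d$ is \emph{primitive} if $X_i$ is connected for every $1\le i\le d$. If $X$ is connected and bipartite with at least two vertices, then $X_2$ has exactly two connected components; these are the \emph{halved graphs} of $X$ (when $X$ is distance-regular, so are they). The \emph{motion} of $X$, $\mathrm{motion}(X)$, is the minimum, over all non-identity automorphisms $\sigma$ of $X$, of the number of vertices not fixed by $\sigma$ (with $\mathrm{motion}(X)=\infty$ if $X$ has no non-identity automorphism). \textbf{Theorem.} Let $X$ be a bipartite distance-regular graph of diameter $d\ge 4$ on $n$ vertices. If at least one of the halved graphs of $X$ is primitive, then $$\mathrm{motion}(X)\ \ge\ (2d)^{-2d-5}\, n .$$ -/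

import Mathlib

open scoped ENNReal

/-- The distance-`i` graph of a graph (used for `i ≥ 1`): distinct vertices are joined when they
are at distance exactly `i`. -/
def distanceGraph {V : Type*} (X : SimpleGraph V) (i : ℕ) : SimpleGraph V where
  Adj u v := u ≠ v ∧ X.dist u v = i
  symm := ⟨fun _ _ h => ⟨h.1.symm, X.dist_comm ▸ h.2⟩⟩
  loopless := ⟨fun _ h => h.1 rfl⟩

/-- A finite graph is distance-regular if it is connected and, for each `i` from `0` to the
diameter, there are constants `a i`, `b i`, `c i` such that every vertex `w` at distance `i` from
a vertex `v` has exactly `a i`, `b i`, `c i` neighbours at distance `i`, `i + 1`, `i - 1`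
from `v`, respectively (no vertex is at distance `-1`). -/
def IsDistanceRegular {V : Type*} [Finite V] (X : SimpleGraph V) : Prop :=
  X.Connected ∧ ∃ a b c : ℕ → ℕ, ∀ i ≤ X.diam, ∀ v w : V, X.dist v w = i →
    {u | X.Adj w u ∧ X.dist v u = i}.ncard = a i ∧
    {u | X.Adj w u ∧ X.dist v u = i + 1}.ncard = b i ∧
    {u | X.Adj w u ∧ X.dist v u + 1 = i}.ncard = c i

/-- The primitivity condition for a finite connected graph: its distance-`i` graph is connected
for every `i` from `1` to the diameter. -/
def IsPrimitiveGraph {V : Type*} [Finite V] (X : SimpleGraph V) : Prop :=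
  X.Connected ∧ ∀ i, 1 ≤ i → i ≤ X.diam → (distanceGraph X i).Connected

/-- The halved graphs of a bipartite graph `X`: the connected components of its distance-`2`
graph, as graphs on their own vertex sets. -/
abbrev halvedGraph {V : Type*} (X : SimpleGraph V)
    (C : (distanceGraph X 2).ConnectedComponent) : SimpleGraph C :=
  C.toSimpleGraph

/-- The motion of a graph: the minimal number of non-fixed vertices of a non-identity
automorphism. It is `⊤` when the identity is the only automorphism. -/
noncomputable def motion {V : Type*} (X : SimpleGraph V) : ℕ∞ :=
  ⨅ (σ : X ≃g X) (_ : σ ≠ 1), {v : V | σ v ≠ v}.encard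

section
open scoped Classical
open Finset

/-! Let `σ` move `v` and have support of size `s`. The proof gives the stronger bound `n ≤ 16 d² s`,
by contradiction. A vertex fixed by `σ` is equidistant from `v` and `σ v`, so at most `s` vertices
distinguish the two. The number `D l` of vertices distinguishing a pair depends only on the distance
`l` of the pair. Primitivity of a halved graph and the triangle inequality for `D` spread the bound
from `l = dist v (σ v)` to all even distances: `D (2l) ≤ F = (d / 2) s`. With almost nothing
distinguished, double counting produces in each colour class, of size `N = n / 2`, a sphere about a
fixed vertex that misses at most `F` points. Sphere sizes are unimodal, so the two large radii are
consecutive, `m` and `m + 1`. The case `m = 0` is absurd. If `m = 1`, then `k 3` is small, hence so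
is `b 2`, against `c 2 ≤ b 2` and `b 2 + c 2 = b 0`. If `m ≥ 2`, then `k (m - 1)` is small, so `c
m`, and with it `c 2`, is tiny compared to `b 0`. A moved vertex has at most `c 2` fixed neighbours,
so the support expands from `v` and fills most of a sphere of radius `m + 1`, exceeding `F ≥ s`. -/

/-- Bipartite distance-regularity with diameter `d` and intersection numbers `b`, `c`, in terms of
finset cardinalities. The bipartite condition says that adjacent vertices are never equidistant
from a third one. -/
structure IsBipartiteDRG {V : Type*} [Fintype V] (X : SimpleGraph V) (d : ℕ) (b c : ℕ → ℕ) :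
    Prop where
  connected : X.Connected
  dist_adj : ∀ v x y, X.Adj x y → X.dist v y = X.dist v x + 1 ∨ X.dist v y + 1 = X.dist v x
  dist_le : ∀ u v, X.dist u v ≤ d
  exists_dist_eq : ∃ u v, X.dist u v = d
  card_forward : ∀ v x, #{y | X.Adj x y ∧ X.dist v y = X.dist v x + 1} = b (X.dist v x)
  card_backward : ∀ v x, #{y | X.Adj x y ∧ X.dist v y + 1 = X.dist v x} = c (X.dist v x)

/-! ### Geodesics, parity and extraction of intersection numbers. -/

theorem SimpleGraph.Connected.exists_dist_eq_of_le {V : Type*} {X : SimpleGraph V}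
    (hX : X.Connected) (u v : V) {i : ℕ} (hi : i ≤ X.dist u v) :
    ∃ w, X.dist u w = i ∧ X.dist w v = X.dist u v - i := by
  obtain ⟨p, hp⟩ := hX.exists_walk_length_eq_dist u v
  have h1 := X.dist_le (p.take i)
  have h2 := X.dist_le (p.drop i)
  have h3 := hX.dist_triangle (u := u) (v := p.getVert i) (w := v)
  rw [SimpleGraph.Walk.take_length] at h1
  rw [SimpleGraph.Walk.drop_length] at h2
  have := min_le_left i p.length
  exact ⟨p.getVert i, by omega, by omega⟩

theorem SimpleGraph.IsBipartite.dist_adj {V : Type*} {X : SimpleGraph V}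
    (hX : X.Connected) (hb : X.IsBipartite) (v x y : V) (h : X.Adj x y) :
    X.dist v y = X.dist v x + 1 ∨ X.dist v y + 1 = X.dist v x := by
  obtain ⟨C⟩ := hb
  let C' : X.Coloring Bool := X.recolorOfEquiv finTwoEquiv C
  obtain ⟨p, hp⟩ := hX.exists_walk_length_eq_dist v x
  obtain ⟨q, hq⟩ := hX.exists_walk_length_eq_dist v y
  have h1 := C'.even_length_iff_congr p
  have h2 := C'.even_length_iff_congr q
  have h3 : C' x ≠ C' y := C'.valid h
  have h4 := hX.dist_triangle (u := v) (v := x) (w := y)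
  have h5 := hX.dist_triangle (u := v) (v := y) (w := x)
  rw [SimpleGraph.dist_eq_one_iff_adj.2 h] at h4
  rw [SimpleGraph.dist_eq_one_iff_adj.2 h.symm] at h5
  have h6 : X.dist v x ≠ X.dist v y := by
    intro he
    rw [hp] at h1
    rw [hq, ← he, h1] at h2
    revert h2 h3
    cases C' v <;> cases C' x <;> cases C' y <;> simp
  omega

variable {V : Type*} [Fintype V] {X : SimpleGraph V} {d : ℕ} {b c : ℕ → ℕ}

theorem IsDistanceRegular.exists_isBipartiteDRG (hX : IsDistanceRegular X)
    (hb : X.IsBipartite) : ∃ b c, IsBipartiteDRG X X.diam b c := by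
  obtain ⟨hc, a, b, c, h⟩ := hX
  have := hc.nonempty
  have hle : ∀ u v, X.dist u v ≤ X.diam := fun u v =>
    SimpleGraph.dist_le_diam (SimpleGraph.connected_iff_ediam_ne_top.1 hc)
  refine ⟨b, c, hc, hb.dist_adj hc, hle, SimpleGraph.exists_dist_eq_diam, fun v x => ?_,
    fun v x => ?_⟩
  · rw [← (h _ (hle v x) v x rfl).2.1, ← Set.ncard_coe_finset]
    simp
  · rw [← (h _ (hle v x) v x rfl).2.2, ← Set.ncard_coe_finset]
    simp

namespace IsBipartiteDRG

/-! ### Sums over spheres (the Bose–Mesner algebra, without matrices). -/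

theorem c_pos (h : IsBipartiteDRG X d b c) {v x : V} (hvx : X.dist v x ≠ 0) :
    0 < c (X.dist v x) := by
  rw [← h.card_backward, card_pos]
  obtain ⟨w, h1, h2⟩ := h.connected.exists_dist_eq_of_le v x (Nat.sub_le _ 1)
  refine ⟨w, ?_⟩
  simp only [mem_filter, mem_univ, true_and]
  refine ⟨(SimpleGraph.dist_eq_one_iff_adj.1 ?_).symm, ?_⟩ <;> omega

/-- At `u = v` the truncated `0 - 1` is harmless, because `c 0 = 0`. -/
theorem sum_adj (h : IsBipartiteDRG X d b c) (f : ℕ → ℚ) (u v : V) :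
    ∑ x with X.Adj u x, f (X.dist x v) =
      b (X.dist u v) * f (X.dist u v + 1) + c (X.dist u v) * f (X.dist u v - 1) := by
  have h1 : (univ.filter fun x => X.Adj u x) =
      (univ.filter fun x => X.Adj u x ∧ X.dist v x = X.dist v u + 1) ∪
      (univ.filter fun x => X.Adj u x ∧ X.dist v x + 1 = X.dist v u) := by
    ext x
    have := h.dist_adj v u x
    simp only [mem_filter, mem_univ, true_and, mem_union]
    tauto
  rw [h1, sum_union, X.dist_comm (u := u), ← h.card_forward v u, ← h.card_backward v u]
  · congr 1
    · rw [← nsmul_eq_mul]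
      refine sum_eq_card_nsmul fun x hx => ?_
      rw [X.dist_comm, (mem_filter.1 hx).2.2]
    · rw [← nsmul_eq_mul]
      refine sum_eq_card_nsmul fun x hx => ?_
      rw [X.dist_comm, ← (mem_filter.1 hx).2.2, Nat.add_sub_cancel]
  · rw [disjoint_left]
    intro x hx hx'
    have h2 := (mem_filter.1 hx).2.2
    have h3 := (mem_filter.1 hx').2.2
    omega

/-- Entrywise form of the recurrence `A A_{i+1} = b_i A_i + c_{i+2} A_{i+2}` for the distance
matrices. -/
theorem card_adj_dist (h : IsBipartiteDRG X d b c) (i : ℕ) (u x : V) :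
    #{y | X.Adj u y ∧ X.dist y x = i + 1} =
      (if X.dist u x = i then b i else 0) + (if X.dist u x = i + 2 then c (i + 2) else 0) := by
  have key := h.sum_adj (fun j => if j = i + 1 then 1 else 0) u x
  rw [← sum_filter, filter_filter, sum_const, nsmul_eq_mul, mul_one] at key
  rw [← Nat.cast_inj (R := ℚ), key]
  split_ifs <;> first | omega | simp_all

/-- Matrices whose entries depend only on distance are stable under multiplication by `A`, hence by
every `A_i`: the three-term recurrence is solved for `A_{i+2}`, dividing by `c (i + 2)`. -/
theorem exists_sum_sphere (h : IsBipartiteDRG X d b c) (i : ℕ) : ∀ f : ℕ → ℚ,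
    ∃ g : ℕ → ℚ, ∀ u v, ∑ x with X.dist u x = i, f (X.dist x v) = g (X.dist u v) := by
  induction i using Nat.twoStepInduction with
  | zero =>
    refine fun f => ⟨f, fun u v => ?_⟩
    simp_rw [h.connected.dist_eq_zero_iff]
    simp [filter_eq]
  | one =>
    refine fun f => ⟨fun l => b l * f (l + 1) + c l * f (l - 1), fun u v => ?_⟩
    simp_rw [SimpleGraph.dist_eq_one_iff_adj]
    exact h.sum_adj f u v
  | more i ih0 ih1 =>
    intro f
    by_cases hi : ∃ u v, X.dist u v = i + 2
    · obtain ⟨u₀, v₀, h0⟩ := hi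
      have hc : (c (i + 2) : ℚ) ≠ 0 := by
        rw [← h0]
        exact_mod_cast (h.c_pos (by omega)).ne'
      obtain ⟨g0, hg0⟩ := ih0 f
      obtain ⟨g1, hg1⟩ := ih1 f
      refine ⟨fun l => (b l * g1 (l + 1) + c l * g1 (l - 1) - b i * g0 l) / c (i + 2),
        fun u v => ?_⟩
      rw [eq_div_iff hc, ← h.sum_adj g1 u v, ← hg0]
      simp_rw [← hg1]
      have hswap : ∑ y with X.Adj u y, ∑ x with X.dist y x = i + 1, f (X.dist x v) =
          ∑ x, (#{y | X.Adj u y ∧ X.dist y x = i + 1} : ℚ) * f (X.dist x v) := by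
        simp_rw [sum_filter (s := univ) (p := fun x => X.dist _ x = i + 1)]
        rw [sum_comm]
        refine sum_congr rfl fun x _ => ?_
        rw [← sum_filter, filter_filter, sum_const, nsmul_eq_mul]
      rw [hswap]
      simp_rw [h.card_adj_dist, sum_filter]
      rw [mul_sum, ← sum_sub_distrib, sum_mul]
      refine sum_congr rfl fun x _ => ?_
      split_ifs <;> first | omega | (push_cast; ring)
    · push Not at hi
      refine ⟨0, fun u v => ?_⟩
      rw [filter_false_of_mem fun x _ => hi u x]
      simp

theorem exists_card_sphere (h : IsBipartiteDRG X d b c) :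
    ∃ k : ℕ → ℕ, ∀ u i, #{x | X.dist u x = i} = k i := by
  obtain ⟨u₀⟩ := h.connected.nonempty
  refine ⟨fun i => #{x | X.dist u₀ x = i}, fun u i => ?_⟩
  obtain ⟨g, hg⟩ := h.exists_sum_sphere i fun _ => 1
  have h1 := hg u u
  have h2 := hg u₀ u₀
  rw [SimpleGraph.dist_self] at h1 h2
  beta_reduce
  rw [← Nat.cast_inj (R := ℚ)]
  simpa using h1.trans h2.symm

theorem card_dist_ne_congr (h : IsBipartiteDRG X d b c) :
    ∃ D : ℕ → ℕ, ∀ u v, #{w | X.dist u w ≠ X.dist v w} = D (X.dist u v) := by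
  have key : ∃ g : ℕ → ℚ, ∀ u v, (#{w | X.dist u w = X.dist v w} : ℚ) = g (X.dist u v) := by
    -- Equidistant vertices are counted by their common distance `i`.
    choose g hg using fun i => h.exists_sum_sphere i fun j => if j = i then 1 else 0
    refine ⟨fun l => ∑ i ∈ range (d + 1), g i l, fun u v => ?_⟩
    simp_rw [← hg]
    rw [card_eq_sum_card_fiberwise (f := fun w => X.dist u w) (t := range (d + 1))
      fun w _ => by simpa [Nat.lt_succ_iff] using h.dist_le u w]
    push_cast
    refine sum_congr rfl fun i _ => ?_
    rw [filter_filter, ← sum_filter, filter_filter, sum_const, nsmul_eq_mul, mul_one]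
    congr 2
    ext w
    simp only [mem_filter, mem_univ, true_and]
    rw [X.dist_comm (u := w)]
    omega
  obtain ⟨g, hg⟩ := key
  refine ⟨fun l => Fintype.card V - ⌊g l⌋₊, fun u v => ?_⟩
  beta_reduce
  rw [← hg, Nat.floor_natCast, ← card_univ,
    ← card_filter_add_card_filter_not (s := univ) fun w => X.dist u w = X.dist v w]
  simp only [ne_eq]
  omega

theorem exists_dist (h : IsBipartiteDRG X d b c) (v : V) {i : ℕ} (hi : i ≤ d) :
    ∃ w, X.dist v w = i := by
  obtain ⟨k, hk⟩ := h.exists_card_sphere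
  obtain ⟨x, y, hxy⟩ := h.exists_dist_eq
  obtain ⟨w, hw, -⟩ := h.connected.exists_dist_eq_of_le x y (hi.trans hxy.ge)
  have h1 : 0 < #{z | X.dist x z = i} := card_pos.2 ⟨w, by simpa using hw⟩
  rw [hk, ← hk v, card_pos] at h1
  obtain ⟨z, hz⟩ := h1
  exact ⟨z, by simpa using hz⟩

/-! ### Inequalities between intersection numbers. -/

theorem card_adj (h : IsBipartiteDRG X d b c) (x : V) : #{y | X.Adj x y} = b 0 := by
  rw [← X.dist_self (v := x), ← h.card_forward x x, SimpleGraph.dist_self]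
  congr 1
  ext y
  simp [SimpleGraph.dist_eq_one_iff_adj]

theorem b_add_c (h : IsBipartiteDRG X d b c) {i : ℕ} (hi : i ≤ d) : b i + c i = b 0 := by
  obtain ⟨v⟩ := h.connected.nonempty
  obtain ⟨x, rfl⟩ := h.exists_dist v hi
  rw [← h.card_adj x, ← h.card_forward, ← h.card_backward, ← card_union_of_disjoint]
  · congr 1
    ext y
    have := h.dist_adj v x y
    simp only [mem_filter, mem_univ, true_and, mem_union]
    tauto
  · rw [disjoint_left]
    intro y hy hy'
    have h2 := (mem_filter.1 hy).2.2
    have h3 := (mem_filter.1 hy').2.2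
    omega

theorem c_le_succ (h : IsBipartiteDRG X d b c) {i : ℕ} (hi : i + 1 ≤ d) : c i ≤ c (i + 1) := by
  obtain ⟨v⟩ := h.connected.nonempty
  obtain ⟨w, hw⟩ := h.exists_dist v hi
  obtain ⟨v', h1, h2⟩ := h.connected.exists_dist_eq_of_le v w (i := 1) (by omega)
  rw [hw, Nat.add_sub_cancel] at h2
  rw [← hw, ← h.card_backward, ← h2, ← h.card_backward, hw, h2]
  refine card_le_card fun y hy => ?_
  simp only [mem_filter, mem_univ, true_and] at hy ⊢
  have h3 := h.connected.dist_triangle (u := v) (v := v') (w := y)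
  have h4 := h.dist_adj v w y hy.1
  exact ⟨hy.1, by omega⟩

theorem c_mono (h : IsBipartiteDRG X d b c) {i j : ℕ} (hij : i ≤ j) (hj : j ≤ d) :
    c i ≤ c j := by
  induction j, hij using Nat.le_induction with
  | base => exact le_rfl
  | succ j _ ih => exact (ih (by omega)).trans (h.c_le_succ hj)

theorem b_anti (h : IsBipartiteDRG X d b c) {i j : ℕ} (hij : i ≤ j) (hj : j ≤ d) :
    b j ≤ b i := by
  have h1 := h.b_add_c hj
  have h2 := h.b_add_c (hij.trans hj)
  have h3 := h.c_mono hij hj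
  omega

/-- At the midpoint `u` of a geodesic of length 4 from `v` to `w`, every neighbour closer to `w` is
farther from `v`. -/
theorem c_two_le_b_two (h : IsBipartiteDRG X d b c) (hd : 4 ≤ d) : c 2 ≤ b 2 := by
  obtain ⟨v⟩ := h.connected.nonempty
  obtain ⟨w, hw⟩ := h.exists_dist v hd
  obtain ⟨u, h1, h2⟩ := h.connected.exists_dist_eq_of_le v w (i := 2) (by omega)
  have h3 : X.dist w u = 2 := by rw [X.dist_comm]; omega
  have e1 := h.card_forward v u
  have e2 := h.card_backward w u
  rw [h1] at e1
  rw [h3] at e2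
  rw [← e1, ← e2]
  refine card_le_card fun y hy => ?_
  simp only [mem_filter, mem_univ, true_and] at hy ⊢
  have h4 := h.connected.dist_triangle (u := v) (v := y) (w := w)
  rw [X.dist_comm (u := y)] at h4
  have h5 := h.dist_adj v u y hy.1
  exact ⟨hy.1, by omega⟩

theorem card_sphere_mul (h : IsBipartiteDRG X d b c) {k : ℕ → ℕ}
    (hk : ∀ u i, #{x | X.dist u x = i} = k i) (i : ℕ) : k i * b i = k (i + 1) * c (i + 1) := by
  obtain ⟨v⟩ := h.connected.nonempty
  rw [← hk v i, ← hk v (i + 1), ← smul_eq_mul, ← smul_eq_mul, ← sum_const, ← sum_const]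
  have key := sum_card_bipartiteAbove_eq_sum_card_bipartiteBelow
    (s := univ.filter fun x => X.dist v x = i) (t := univ.filter fun x => X.dist v x = i + 1) X.Adj
  convert key using 1
  · refine sum_congr rfl fun x hx => ?_
    rw [mem_filter] at hx
    rw [← hx.2, ← h.card_forward, bipartiteAbove, filter_filter]
    simp_rw [and_comm]
  · refine sum_congr rfl fun x hx => ?_
    rw [mem_filter] at hx
    rw [← hx.2, ← h.card_backward, bipartiteBelow, filter_filter]
    congr 1
    ext y
    simp only [mem_filter, mem_univ, true_and, X.adj_comm x, hx.2, Nat.add_right_cancel_iff]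
    exact and_comm

/-! ### Colour classes and large spheres. -/

theorem even_dist_adj (h : IsBipartiteDRG X d b c) (v : V) {x y : V} (hxy : X.Adj x y) :
    Even (X.dist v x) ↔ ¬ Even (X.dist v y) := by
  obtain h1 | h1 := h.dist_adj v x y hxy
  · rw [h1, Nat.even_add_one, not_not]
  · rw [← h1, Nat.even_add_one]

/-- The two colour classes of a bipartite distance-regular graph have the same size. -/
theorem card_even_odd (h : IsBipartiteDRG X d b c) (hd : 1 ≤ d) :
    ∃ N, 0 < N ∧ Fintype.card V = 2 * N ∧
      ∀ u, #{v | Even (X.dist u v)} = N ∧ #{v | ¬ Even (X.dist u v)} = N := by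
  obtain ⟨k, hk⟩ := h.exists_card_sphere
  have he : ∀ u, #{v | Even (X.dist u v)} = ∑ i ∈ range (d + 1), if Even i then k i else 0 := by
    intro u
    rw [card_eq_sum_card_fiberwise (f := fun w => X.dist u w) (t := range (d + 1))
      fun w _ => by simpa [Nat.lt_succ_iff] using h.dist_le u w]
    refine sum_congr rfl fun i _ => ?_
    rw [filter_filter]
    split_ifs with hi
    · rw [← hk u]
      congr 1
      ext w
      simp only [mem_filter, mem_univ, true_and]
      exact ⟨And.right, fun hw => ⟨hw ▸ hi, hw⟩⟩
    · rw [card_eq_zero]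
      refine filter_false_of_mem fun w _ hw => hi (hw.2 ▸ hw.1)
  have ho : ∀ u, #{v | ¬ Even (X.dist u v)} =
      ∑ i ∈ range (d + 1), if Even i then k i else 0 := by
    intro u
    obtain ⟨u', hu'⟩ := h.exists_dist u hd
    -- The odd class of `u` is the even class of its neighbour `u'`.
    rw [SimpleGraph.dist_eq_one_iff_adj] at hu'
    rw [← he u']
    congr 1
    ext w
    simp only [mem_filter, mem_univ, true_and]
    rw [X.dist_comm, X.dist_comm (u := u'), h.even_dist_adj w hu', not_not]
  obtain ⟨v⟩ := h.connected.nonempty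
  refine ⟨∑ i ∈ range (d + 1), if Even i then k i else 0, ?_, ?_, fun u => ⟨he u, ho u⟩⟩
  · rw [← he v, card_pos]
    exact ⟨v, by simp⟩
  · rw [← card_univ, ← card_filter_add_card_filter_not (s := univ) fun w => Even (X.dist v w),
      he, ho, two_mul]

/-- If no vertex at even distance from `u` is distinguished from `u` by more than `F` vertices,
then each colour class contains a large sphere around `u`. -/
theorem exists_large_sphere {k : ℕ → ℕ}
    (hk : ∀ u i, #{x | X.dist u x = i} = k i) {u : V} {N F : ℕ} (hN : 0 < N)
    (hQ : #{v | Even (X.dist u v)} = N)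
    (hF : ∀ v, Even (X.dist u v) → #{w | X.dist u w ≠ X.dist v w} ≤ F)
    (W : Finset V) (hW : #W = N) : ∃ w ∈ W, N ≤ k (X.dist u w) + F := by
  by_contra! hlt
  -- Double count of pairs `(w, v)` with `w` distinguishing `v` from `u`: at most `N * F` seen from
  -- `v`, at least `N * (F + 1)` seen from `w` if no sphere is large.
  have key := sum_card_bipartiteAbove_eq_sum_card_bipartiteBelow
    (s := W) (t := univ.filter fun v => Even (X.dist u v)) fun w v => X.dist u w ≠ X.dist v w
  have h1 : ∑ v with Even (X.dist u v), #(W.bipartiteBelow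
      (fun w v => X.dist u w ≠ X.dist v w) v) ≤ N * F := by
    rw [← hQ, ← smul_eq_mul]
    refine sum_le_card_nsmul _ _ _ fun v hv => ?_
    refine le_trans (card_le_card ?_) (hF v (by simpa using hv))
    exact filter_subset_filter _ (subset_univ _)
  have h2 : N * (F + 1) ≤ ∑ w ∈ W, #((univ.filter fun v => Even (X.dist u v)).bipartiteAbove
      (fun w v => X.dist u w ≠ X.dist v w) w) := by
    rw [← hW, ← smul_eq_mul]
    refine card_nsmul_le_sum _ _ _ fun w hw => ?_
    have h3 := hlt w hw
    rw [bipartiteAbove]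
    have h4 := card_filter_add_card_filter_not (s := univ.filter fun v => Even (X.dist u v))
      fun v => X.dist u w = X.dist v w
    -- A `v` not distinguished from `u` by `w` lies on the sphere about `w` through `u`.
    have h5 : #{v ∈ univ.filter fun v => Even (X.dist u v) | X.dist u w = X.dist v w} ≤
        k (X.dist u w) := by
      rw [← hk w]
      refine card_le_card fun v hv => ?_
      simp only [mem_filter, mem_univ, true_and] at hv ⊢
      rw [X.dist_comm, ← hv.2]
    simp only [ne_eq]
    omega
  rw [key] at h2
  have := h2.trans h1
  nlinarith

/-! ### Expansion of the support of an automorphism. -/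

section Support

variable (σ : X ≃g X)

/-- A fixed neighbour of `x` is also adjacent to `σ x`; if one exists, `x` and `σ x` are at distance
2 with at most `c 2` common neighbours. -/
theorem card_fixed_adj_le (h : IsBipartiteDRG X d b c) {x : V} (hx : σ x ≠ x) :
    #{y | X.Adj x y ∧ σ y = y} ≤ c 2 := by
  by_cases hy : ∃ y, X.Adj x y ∧ σ y = y
  · have hadj : ∀ y, X.Adj x y → σ y = y → X.Adj (σ x) y := fun y h1 h2 => by
      rw [← h2]
      exact σ.map_adj_iff.2 h1
    obtain ⟨y, h1, h2⟩ := hy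
    have h3 := h.dist_adj x y (σ x) (hadj y h1 h2).symm
    rw [SimpleGraph.dist_eq_one_iff_adj.2 h1] at h3
    have h4 := h.connected.pos_dist_of_ne hx.symm
    have h5 : X.dist x (σ x) = 2 := by omega
    rw [← h5, ← h.card_backward]
    refine card_le_card fun z hz => ?_
    simp only [mem_filter, mem_univ, true_and] at hz ⊢
    exact ⟨hadj z hz.1 hz.2, by rw [SimpleGraph.dist_eq_one_iff_adj.2 hz.1, h5]⟩
  · push Not at hy
    rw [filter_false_of_mem fun y _ hy' => hy y hy'.1 hy'.2]
    simp

/-- The support of an automorphism expands from each sphere to the next one. -/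
theorem support_sphere_mul_le (h : IsBipartiteDRG X d b c) (v : V) (j : ℕ) :
    #{x | σ x ≠ x ∧ X.dist v x = j} * b j ≤
      #{x | σ x ≠ x ∧ X.dist v x = j + 1} * c (j + 1) +
        #{x | σ x ≠ x ∧ X.dist v x = j} * c 2 := by
  -- Counts edges between the moved vertices of the two spheres.
  have key := sum_card_bipartiteAbove_eq_sum_card_bipartiteBelow
    (s := univ.filter fun x => σ x ≠ x ∧ X.dist v x = j)
    (t := univ.filter fun x => σ x ≠ x ∧ X.dist v x = j + 1) X.Adj
  have h1 : ∑ y with σ y ≠ y ∧ X.dist v y = j + 1, #((univ.filter fun x =>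
      σ x ≠ x ∧ X.dist v x = j).bipartiteBelow X.Adj y) ≤
      #{x | σ x ≠ x ∧ X.dist v x = j + 1} * c (j + 1) := by
    rw [← smul_eq_mul]
    refine sum_le_card_nsmul _ _ _ fun y hy => ?_
    simp only [mem_filter, mem_univ, true_and] at hy
    rw [← hy.2, ← h.card_backward]
    refine card_le_card fun x hx => ?_
    simp only [mem_filter, mem_univ, true_and, bipartiteBelow] at hx ⊢
    exact ⟨hx.2.symm, by omega⟩
  have h2 : #{x | σ x ≠ x ∧ X.dist v x = j} * b j ≤ (∑ x with σ x ≠ x ∧ X.dist v x = j,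
      #((univ.filter fun y => σ y ≠ y ∧ X.dist v y = j + 1).bipartiteAbove X.Adj x)) +
        #{x | σ x ≠ x ∧ X.dist v x = j} * c 2 := by
    rw [← smul_eq_mul, ← smul_eq_mul, ← sum_const, ← sum_const, ← sum_add_distrib]
    refine sum_le_sum fun x hx => ?_
    simp only [mem_filter, mem_univ, true_and] at hx
    rw [← hx.2, ← h.card_forward]
    refine le_trans ?_ (Nat.add_le_add_left (h.card_fixed_adj_le σ hx.1) _)
    refine le_trans (card_le_card fun y hy => ?_) (card_union_le _ _)
    simp only [mem_filter, mem_univ, true_and, bipartiteAbove, mem_union] at hy ⊢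
    tauto
  omega

theorem dist_map_le (h : IsBipartiteDRG X d b c) (x y : V) :
    X.dist (σ x) (σ y) ≤ X.dist x y := by
  obtain ⟨p, hp⟩ := h.connected.exists_walk_length_eq_dist x y
  rw [← hp, ← p.length_map σ.toHom]
  exact X.dist_le _

/-- Only moved vertices distinguish a vertex from its image. -/
theorem card_dist_ne_le_support (h : IsBipartiteDRG X d b c) (x : V) :
    #{w | X.dist x w ≠ X.dist (σ x) w} ≤ #{w | σ w ≠ w} := by
  refine card_le_card fun w hw => ?_
  simp only [mem_filter, mem_univ, true_and] at hw ⊢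
  intro hσ
  have h1 := h.dist_map_le σ x w
  have h2 := h.dist_map_le σ.symm (σ x) (σ w)
  rw [RelIso.symm_apply_apply, RelIso.symm_apply_apply] at h2
  rw [hσ] at h1 h2
  exact hw (h2.antisymm h1)

end Support

/-! ### Distances in the halved graphs. -/

/-- Distances from a fixed vertex add up modulo two. -/
theorem even_dist_trans (h : IsBipartiteDRG X d b c) (u v w : V) :
    Even (X.dist v w) ↔ (Even (X.dist u v) ↔ Even (X.dist u w)) := by
  obtain ⟨p⟩ := h.connected v w
  induction p with
  | nil => simp
  | cons hadj _ ih =>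
    rename_i x y z _
    rw [X.dist_comm, h.even_dist_adj z hadj, X.dist_comm, ih, h.even_dist_adj u hadj]
    tauto

theorem even_dist_of_reachable (h : IsBipartiteDRG X d b c) {u v : V}
    (huv : (distanceGraph X 2).Reachable u v) : Even (X.dist u v) := by
  obtain ⟨p⟩ := huv
  induction p with
  | nil => simp
  | cons hadj _ ih =>
    rename_i x y z _
    rw [h.even_dist_trans y, X.dist_comm, hadj.2]
    exact iff_of_true even_two ih

theorem exists_walk_halved (h : IsBipartiteDRG X d b c)
    {C : (distanceGraph X 2).ConnectedComponent} (j : ℕ) : ∀ (u : C) (v : V),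
    X.dist u v = 2 * j → ∃ hv : v ∈ C, ∃ p : (halvedGraph X C).Walk u ⟨v, hv⟩, p.length = j := by
  induction j with
  | zero =>
    intro u v huv
    obtain rfl : u.1 = v := h.connected.dist_eq_zero_iff.1 huv
    exact ⟨u.2, .nil, rfl⟩
  | succ j ih =>
    intro u v huv
    obtain ⟨w, h1, h2⟩ := h.connected.exists_dist_eq_of_le u.1 v (i := 2) (by omega)
    have hadj : (distanceGraph X 2).Adj u w :=
      ⟨fun he => by rw [← he, SimpleGraph.dist_self] at h1; omega, h1⟩
    have hw : w ∈ C := C.mem_supp_of_adj_mem_supp u.2 hadj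
    obtain ⟨hv, p, hp⟩ := ih ⟨w, hw⟩ v (by simp only; omega)
    have hadj' : (halvedGraph X C).Adj u ⟨w, hw⟩ := hadj
    exact ⟨hv, .cons hadj' p, by simp [hp]⟩

theorem dist_eq_two_mul_dist_halved (h : IsBipartiteDRG X d b c)
    {C : (distanceGraph X 2).ConnectedComponent} (u v : C) :
    X.dist u v = 2 * (halvedGraph X C).dist u v := by
  have hle : ∀ {u v : C} (p : (halvedGraph X C).Walk u v), X.dist u v ≤ 2 * p.length := by
    intro u v p
    induction p with
    | nil => simp
    | cons hadj p ih =>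
      rename_i x y z
      have h1 := h.connected.dist_triangle (u := x.1) (v := y.1) (w := z.1)
      have h2 : X.dist x y = 2 := (show (distanceGraph X 2).Adj x y from hadj).2
      rw [SimpleGraph.Walk.length_cons]
      omega
  obtain ⟨p, hp⟩ := C.connected_toSimpleGraph.exists_walk_length_eq_dist u v
  have h1 := hle p
  rw [hp] at h1
  obtain ⟨j, hj⟩ := h.even_dist_of_reachable (SimpleGraph.ConnectedComponent.eq.1
    ((C.mem_supp_iff _).1 u.2 |>.trans ((C.mem_supp_iff _).1 v.2).symm))
  obtain ⟨_, q, hq⟩ := h.exists_walk_halved j u v.1 (by omega)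
  have h2 := SimpleGraph.dist_le q
  have h3 : (halvedGraph X C).dist u v ≤ j := hq ▸ h2
  exact le_antisymm h1 (by omega)

/-- If a halved graph is primitive, then every even distance graph connects its vertices. -/
theorem reachable_distanceGraph (h : IsBipartiteDRG X d b c)
    {C : (distanceGraph X 2).ConnectedComponent} (hC : IsPrimitiveGraph (halvedGraph X C))
    {u : V} (hu : u ∈ C) {i : ℕ} (hi : 1 ≤ i) (hid : 2 * i ≤ d) {w : V}
    (hw : Even (X.dist u w)) : (distanceGraph X (2 * i)).Reachable u w := by
  obtain ⟨j, hj⟩ := hw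
  obtain ⟨hwC, -⟩ := h.exists_walk_halved j ⟨u, hu⟩ w (by simp only; omega)
  -- The vertex `z` witnesses that `i` is at most the diameter of the halved graph.
  obtain ⟨z, hz⟩ := h.exists_dist u hid
  obtain ⟨hzC, -⟩ := h.exists_walk_halved i ⟨u, hu⟩ z hz
  have h1 := h.dist_eq_two_mul_dist_halved ⟨u, hu⟩ (⟨z, hzC⟩ : C)
  have : Nonempty C := ⟨⟨u, hu⟩⟩
  have h2 := SimpleGraph.dist_le_diam (SimpleGraph.connected_iff_ediam_ne_top.1 hC.1)
    (u := ⟨u, hu⟩) (v := (⟨z, hzC⟩ : C))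
  have h3 := (hC.2 i hi (by simp only at h1; omega)) ⟨u, hu⟩ (⟨w, hwC⟩ : C)
  let f : distanceGraph (halvedGraph X C) i →g distanceGraph X (2 * i) :=
    { toFun := Subtype.val
      map_rel' := fun {x y} hxy =>
        ⟨fun he => hxy.1 (Subtype.ext he), by rw [h.dist_eq_two_mul_dist_halved, hxy.2]⟩ }
  exact h3.map f

/-! ### Spreading the bound on distinguishing vertices. -/

/-- Every even distance is distinguished at most `d / 2` times as well as any given one. -/
theorem card_dist_ne_le_mul (h : IsBipartiteDRG X d b c) {D : ℕ → ℕ}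
    (hD : ∀ u v, #{w | X.dist u w ≠ X.dist v w} = D (X.dist u v)) {u : V} {i s : ℕ}
    (hreach : ∀ w, Even (X.dist u w) → (distanceGraph X (2 * i)).Reachable u w)
    (hs : D (2 * i) ≤ s) {l : ℕ} (hl : 2 * l ≤ d) : D (2 * l) ≤ d / 2 * s := by
  have hD0 : D 0 = 0 := by rw [← X.dist_self (v := u), ← hD]; simp
  have htri : ∀ x y z, D (X.dist x z) ≤ D (X.dist x y) + D (X.dist y z) := by
    intro x y z
    rw [← hD, ← hD, ← hD]
    refine le_trans (card_le_card fun w hw => ?_) (card_union_le _ _)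
    simp only [mem_filter, mem_univ, true_and, mem_union] at hw ⊢
    omega
  -- Each increase of `r` admits at least one new value of `l` until all `d / 2 + 1` are present, so
  -- `r = d / 2` suffices.
  have key : ∀ r, min (r + 1) (d / 2 + 1) ≤ #{l ∈ range (d / 2 + 1) | D (2 * l) ≤ r * s} := by
    intro r
    induction r with
    | zero =>
      refine le_trans (min_le_left _ _) (Nat.one_le_iff_ne_zero.2 (card_ne_zero.2 ⟨0, ?_⟩))
      simp [hD0]
    | succ r ih =>
      have hsub : {l ∈ range (d / 2 + 1) | D (2 * l) ≤ r * s} ⊆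
          {l ∈ range (d / 2 + 1) | D (2 * l) ≤ (r + 1) * s} := by
        refine monotone_filter_right _ fun l _ hl => hl.trans ?_
        gcongr
        omega
      by_cases hall : ∀ l ∈ range (d / 2 + 1), D (2 * l) ≤ r * s
      · rw [filter_true_of_mem fun l hl => (hall l hl).trans (by gcongr; omega), card_range]
        exact min_le_right _ _
      · push Not at hall
        obtain ⟨l, hl, hlt⟩ := hall
        have hl' : 2 * l ≤ d := by rw [mem_range] at hl; omega
        obtain ⟨w, hw⟩ := h.exists_dist u hl'
        -- Along a walk in the distance-`2 * i` graph, `D (dist u ·)` grows by at most `s` per edge,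
        -- so its first value above `r * s` is at most `(r + 1) * s`.
        have hstep : ∀ {x y : V}, (distanceGraph X (2 * i)).Reachable x y →
            Even (X.dist u x) → D (X.dist u x) ≤ r * s → r * s < D (X.dist u y) →
            ∃ z, Even (X.dist u z) ∧ r * s < D (X.dist u z) ∧ D (X.dist u z) ≤ (r + 1) * s := by
          rintro x y ⟨p⟩
          induction p with
          | nil => intro _ h1 h2; omega
          | cons hadj p ih =>
            rename_i x y z
            intro h0 h1 h2
            have h3 := htri u x y
            rw [hadj.2] at h3
            have h4 : Even (X.dist u y) := by
              have := (h.even_dist_trans u x y).1 (by rw [hadj.2]; exact even_two_mul i)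
              exact this.1 h0
            by_cases h5 : D (X.dist u y) ≤ r * s
            · exact ih h4 h5 h2
            · refine ⟨y, h4, by omega, ?_⟩
              rw [add_mul]
              omega
        obtain ⟨z, ⟨j, hj⟩, hz1, hz2⟩ := hstep (hreach w (by rw [hw]; exact even_two_mul l))
          (by simp) (by simp [hD0]) (by rwa [hw])
        have hzd := h.dist_le u z
        rw [← two_mul] at hj
        rw [hj] at hz1 hz2 hzd
        have hlt : #{l ∈ range (d / 2 + 1) | D (2 * l) ≤ r * s} <
            #{l ∈ range (d / 2 + 1) | D (2 * l) ≤ (r + 1) * s} := by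
          refine card_lt_card ((ssubset_iff_of_subset hsub).2 ⟨j, ?_, ?_⟩)
          · simp only [mem_filter, mem_range]
            exact ⟨by omega, hz2⟩
          · simp only [mem_filter, mem_range]
            omega
        omega
  have h1 := key (d / 2)
  rw [min_self] at h1
  have h2 := filter_card_eq (s := range (d / 2 + 1)) (p := fun l => D (2 * l) ≤ d / 2 * s)
    (le_antisymm (card_filter_le _ _) (by rwa [card_range]))
  exact h2 l (by rw [mem_range]; omega)

/-! ### Two large consecutive spheres, and the contradiction. -/

theorem c_succ_pos (h : IsBipartiteDRG X d b c) {i : ℕ} (hi : i + 1 ≤ d) : 0 < c (i + 1) := by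
  obtain ⟨v⟩ := h.connected.nonempty
  obtain ⟨w, hw⟩ := h.exists_dist v hi
  rw [← hw]
  exact h.c_pos (by omega)

/-- Sphere sizes are unimodal, so two large spheres of opposite parity separated by a small one
cannot exist. -/
theorem eq_succ_of_large (h : IsBipartiteDRG X d b c) {k : ℕ → ℕ}
    (hk : ∀ u i, #{x | X.dist u x = i} = k i) {p q F : ℕ} (hpq : p + 1 ≤ q) (hq : q ≤ d)
    (hp : F < k p) (hqF : F < k q) (hsmall : p + 1 ≠ q → k (p + 1) ≤ F) : q = p + 1 := by
  by_contra hne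
  have hs := hsmall (Ne.symm hne)
  -- Sizes drop from `p` to `p + 1`; monotonicity of `b` and `c` makes them keep dropping.
  have hlt : b p ≤ c (p + 1) := by
    have h1 := h.card_sphere_mul hk p
    by_contra! hlt
    have : k (p + 1) * c (p + 1) < k p * b p :=
      Nat.mul_lt_mul_of_le_of_lt (by omega) hlt (by omega)
    omega
  have key : ∀ j, p + 1 ≤ j → j ≤ d → k j ≤ F := by
    intro j hj
    induction j, hj using Nat.le_induction with
    | base => exact fun _ => hs
    | succ j hj ih =>
      intro hjd
      refine le_trans ?_ (ih (by omega))
      have h1 := h.card_sphere_mul hk j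
      have h2 := h.b_anti (i := p) (j := j) (by omega) (by omega)
      have h3 := h.c_mono (i := p + 1) (j := j + 1) (by omega) hjd
      refine Nat.le_of_mul_le_mul_right ?_ (h.c_succ_pos hjd)
      rw [← h1]
      exact Nat.mul_le_mul_left _ (h2.trans (hlt.trans h3))
  exact absurd (key q hpq hq) (by omega)

/-- If the support of an automorphism contains `v` and `c 2` is small compared to `b j` for
`j < m`, then the support contains most of the sphere of radius `m` around `v`. -/
theorem card_sphere_mul_le_support (h : IsBipartiteDRG X d b c) {k : ℕ → ℕ}
    (hk : ∀ u i, #{x | X.dist u x = i} = k i) (σ : X ≃g X) {v : V} (hv : σ v ≠ v) {t : ℝ}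
    (ht : 0 ≤ t) {m : ℕ} (hm : m ≤ d) (htm : m * t ≤ 1) (hb : ∀ j < m, (c 2 : ℝ) ≤ t * b j) :
    (k m : ℝ) * (1 - m * t) ≤ #{x | σ x ≠ x ∧ X.dist v x = m} := by
  induction m with
  | zero =>
    rw [← hk v 0]
    simp only [CharP.cast_eq_zero, zero_mul, sub_zero, mul_one, Nat.cast_le]
    refine card_le_card fun x hx => ?_
    simp only [mem_filter, mem_univ, true_and] at hx ⊢
    rw [← h.connected.dist_eq_zero_iff.1 hx]
    exact ⟨hv, by simp⟩
  | succ m ih =>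
    have htm' : m * t + t ≤ 1 := by
      push_cast at htm
      linarith
    have h1 := ih (by omega) (by linarith) fun j hj => hb j (by omega)
    have h2 : (k m : ℝ) * b m = k (m + 1) * c (m + 1) := mod_cast h.card_sphere_mul hk m
    have h3 : (#{x | σ x ≠ x ∧ X.dist v x = m} : ℝ) * b m ≤
        #{x | σ x ≠ x ∧ X.dist v x = m + 1} * c (m + 1) +
          #{x | σ x ≠ x ∧ X.dist v x = m} * c 2 := mod_cast h.support_sphere_mul_le σ v m
    have h4 : (0 : ℝ) < c (m + 1) := mod_cast h.c_succ_pos hm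
    have h5 := hb m (by omega)
    have h6 : 0 ≤ m * t := by positivity
    refine le_of_mul_le_mul_right ?_ h4
    generalize (#{x | σ x ≠ x ∧ X.dist v x = m} : ℝ) = A at *
    generalize (#{x | σ x ≠ x ∧ X.dist v x = m + 1} : ℝ) = B at *
    have hA : 0 ≤ A := le_trans (mul_nonneg (Nat.cast_nonneg _) (by linarith)) h1
    -- Each sphere costs a factor `1 - t`, and `1 - (m + 1) t ≤ (1 - m t)(1 - t)`.
    calc (k (m + 1) : ℝ) * (1 - ((m + 1 : ℕ) : ℝ) * t) * c (m + 1)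
        = k m * b m * (1 - m * t - t) := by rw [h2]; push_cast; ring
      _ ≤ k m * b m * ((1 - m * t) * (1 - t)) := by
          gcongr
          nlinarith
      _ = k m * (1 - m * t) * (b m * (1 - t)) := by ring
      _ ≤ A * (b m * (1 - t)) := by
          gcongr
          exact mul_nonneg (Nat.cast_nonneg _) (by linarith)
      _ = A * b m - A * (t * b m) := by ring
      _ ≤ A * b m - A * c 2 := by gcongr
      _ ≤ B * c (m + 1) := by linarith

/-- Consecutive spheres covering almost the whole graph force large supports. -/
theorem lt_support_of_large (h : IsBipartiteDRG X d b c) {k : ℕ → ℕ}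
    (hk : ∀ u i, #{x | X.dist u x = i} = k i) (hd : 4 ≤ d) {N F m : ℕ} (hF : 0 < F)
    (hNF : 16 * d * F ≤ N) (hm : m + 1 ≤ d) (hm0 : N ≤ k m + F) (hm1 : N ≤ k (m + 1) + F)
    (hsmall : ∀ i j, i ≠ j → (Even i ↔ Even j) → k i + k j ≤ N)
    (σ : X ≃g X) {v : V} (hv : σ v ≠ v) : F < #{w | σ w ≠ w} := by
  have hNF' : 64 * F ≤ N := le_trans (by gcongr; omega) hNF
  -- A large sphere has at least `16 d F - F ≥ 15 d F` points.
  have hratio : ∀ {i x y : ℕ}, N ≤ k i + F → x * k i ≤ F * y → 15 * d * x ≤ y := by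
    intro i x y hi hxy
    refine Nat.le_of_mul_le_mul_left ?_ hF
    refine le_trans ?_ hxy
    have : 15 * d * F ≤ k i := by nlinarith
    nlinarith
  have hb0 : ∀ i ≤ d, b i ≤ b 0 := fun i hi => h.b_anti (Nat.zero_le _) hi
  have hpos : 0 < b 0 := by
    have := h.b_add_c (i := 1) (by omega)
    have := h.c_succ_pos (i := 0) (by omega)
    simp only [zero_add] at this
    omega
  obtain rfl | rfl | hm2 : m = 0 ∨ m = 1 ∨ 2 ≤ m := by omega
  · have h1 : k 0 = 1 := by
      rw [← hk v 0]
      simp_rw [h.connected.dist_eq_zero_iff]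
      simp [filter_eq]
    omega
  · have h1 := h.card_sphere_mul hk 2
    have h2 := hsmall 3 1 (by omega) (by decide)
    have h3 := h.b_add_c (i := 3) (by omega)
    have h4 : 15 * d * b 2 ≤ b 0 := by
      refine hratio hm1 ?_
      rw [mul_comm, show 1 + 1 = 2 from rfl, h1]
      exact Nat.mul_le_mul (show k 3 ≤ F by omega) (show c 3 ≤ b 0 by omega)
    have h5 := h.c_two_le_b_two hd
    have h6 := h.b_add_c (i := 2) (by omega)
    have h7 : 60 * b 2 ≤ 15 * d * b 2 := by gcongr; omega
    omega
  · obtain ⟨m, rfl⟩ : ∃ m', m = m' + 1 := ⟨m - 1, by omega⟩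
    have h1 := h.card_sphere_mul hk m
    have h2 := hsmall m (m + 1 + 1) (by omega) (by simp [Nat.even_add_one])
    have h3 : 15 * d * c (m + 1) ≤ b 0 := by
      refine hratio hm0 ?_
      rw [mul_comm, ← h1]
      exact Nat.mul_le_mul (by omega) (hb0 m (by omega))
    have h4 := h.c_mono hm2 (by omega)
    have hd0 : (0 : ℝ) < d := by
      have : 0 < d := by omega
      exact_mod_cast this
    -- Here `b j ≥ b 0 - c (m + 1) ≥ (15 d - 1) c 2`. The weaker factor `7 d` suffices: at most `d`
    -- steps then lose at most `1 / 7`.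
    have h5 : ∀ j < m + 1 + 1, (c 2 : ℝ) ≤ (7 * d : ℝ)⁻¹ * b j := by
      intro j hj
      rw [← div_eq_inv_mul, le_div_iff₀ (by positivity)]
      have h6 := h.b_anti (i := j) (j := m + 1) (by omega) (by omega)
      have h7 := h.b_add_c (i := m + 1) (by omega)
      have h8 : c 2 * (7 * d) ≤ b j := by nlinarith
      exact_mod_cast h8
    have hmd : ((m + 1 + 1 : ℕ) : ℝ) * (7 * d : ℝ)⁻¹ ≤ 1 / 7 := by
      rw [← div_eq_mul_inv, div_le_iff₀ (by positivity)]
      have : ((m + 1 + 1 : ℕ) : ℝ) ≤ d := mod_cast hm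
      linarith
    have h6 := h.card_sphere_mul_le_support hk σ hv (by positivity) hm (by linarith) h5
    have h7 : #{x | σ x ≠ x ∧ X.dist v x = m + 1 + 1} ≤ #{w | σ w ≠ w} :=
      card_le_card (monotone_filter_right _ fun _ _ hx => hx.1)
    have h8 : (k (m + 1 + 1) : ℝ) * (6 / 7) ≤ #{w | σ w ≠ w} := by
      refine le_trans ?_ (h6.trans (mod_cast h7))
      gcongr
      linarith
    have h9 : (63 * F : ℝ) ≤ k (m + 1 + 1) := by
      have : 63 * F ≤ k (m + 1 + 1) := by omega
      exact_mod_cast this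
    have h10 : (0 : ℝ) < F := mod_cast hF
    have h11 : (F : ℝ) < #{w | σ w ≠ w} := by linarith
    exact_mod_cast h11

theorem card_le_support (h : IsBipartiteDRG X d b c) (hd : 4 ≤ d)
    {C : (distanceGraph X 2).ConnectedComponent} (hC : IsPrimitiveGraph (halvedGraph X C))
    (σ : X ≃g X) {v : V} (hv : σ v ≠ v) :
    Fintype.card V ≤ 16 * d ^ 2 * #{w | σ w ≠ w} := by
  by_contra! hlt
  set s := #{w | σ w ≠ w} with hs
  obtain ⟨D, hD⟩ := h.card_dist_ne_congr
  obtain ⟨k, hk⟩ := h.exists_card_sphere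
  obtain ⟨N, hN, hVN, hcard⟩ := h.card_even_odd (by omega)
  have hs0 : 0 < s := card_pos.2 ⟨v, by simpa using hv⟩
  have hDs := h.card_dist_ne_le_support σ v
  rw [← hs] at hDs
  -- At odd distance every vertex would distinguish `v` from `σ v`, giving `n ≤ s`.
  have heven : Even (X.dist v (σ v)) := by
    by_contra hodd
    rw [filter_true_of_mem, card_univ] at hDs
    · have h1 : 1 * s ≤ 16 * d ^ 2 * s := Nat.mul_le_mul_right _ (by nlinarith)
      omega
    · intro w _ hw
      rw [h.even_dist_trans w, X.dist_comm, hw, X.dist_comm] at hodd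
      exact hodd Iff.rfl
  obtain ⟨i, hi⟩ := heven
  have hi0 := h.connected.pos_dist_of_ne hv.symm
  have hid := h.dist_le v (σ v)
  rw [← two_mul] at hi
  rw [hD, hi] at hDs
  obtain ⟨u, hu⟩ := C.nonempty_supp
  have hreach : ∀ w, Even (X.dist u w) → (distanceGraph X (2 * i)).Reachable u w :=
    fun w hw => h.reachable_distanceGraph hC hu (by omega) (by omega) hw
  have hF : ∀ w, Even (X.dist u w) → #{z | X.dist u z ≠ X.dist w z} ≤ d / 2 * s := by
    rintro w ⟨l, hl⟩
    rw [← two_mul] at hl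
    rw [hD, hl]
    exact h.card_dist_ne_le_mul hD hreach hDs (hl ▸ h.dist_le u w)
  have hd2 : 2 * (d / 2) ≤ d := Nat.mul_div_le d 2
  have hNF : 16 * d * (d / 2 * s) ≤ N := by
    have : 16 * d * (d / 2 * s) ≤ 8 * d ^ 2 * s := by
      calc 16 * d * (d / 2 * s) = 8 * d * s * (2 * (d / 2)) := by ring
        _ ≤ 8 * d * s * d := by gcongr
        _ = 8 * d ^ 2 * s := by ring
    nlinarith
  have hd2' : 2 ≤ d / 2 := by omega
  have hFpos : 0 < d / 2 * s := by positivity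
  have hsF : s ≤ d / 2 * s := Nat.le_mul_of_pos_left _ (by omega)
  generalize d / 2 * s = F at *
  have hNF' : 64 * F ≤ N := le_trans (by gcongr; omega) hNF
  have hsmall : ∀ i j, i ≠ j → (Even i ↔ Even j) → k i + k j ≤ N := by
    intro i j hij hpar
    rw [← hk u i, ← hk u j, ← card_union_of_disjoint]
    · by_cases hie : Even i
      · rw [← (hcard u).1]
        refine card_le_card fun x hx => ?_
        simp only [mem_filter, mem_univ, true_and, mem_union] at hx ⊢
        obtain hx | hx := hx <;> rw [hx] <;> tauto
      · rw [← (hcard u).2]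
        refine card_le_card fun x hx => ?_
        simp only [mem_filter, mem_univ, true_and, mem_union] at hx ⊢
        obtain hx | hx := hx <;> rw [hx] <;> tauto
    · rw [disjoint_left]
      intro x hx hx'
      simp only [mem_filter, mem_univ, true_and] at hx hx'
      omega
  obtain ⟨x, hx, hxN⟩ := exists_large_sphere hk hN (hcard u).1 hF _ (hcard u).1
  obtain ⟨y, hy, hyN⟩ := exists_large_sphere hk hN (hcard u).1 hF _ (hcard u).2
  have hxd := h.dist_le u x
  have hyd := h.dist_le u y
  replace hx := (mem_filter.1 hx).2
  replace hy := (mem_filter.1 hy).2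
  generalize X.dist u x = p at *
  generalize X.dist u y = q at *
  have hsup : ∀ m, m + 1 ≤ d → N ≤ k m + F → N ≤ k (m + 1) + F → False := fun m h1 h2 h3 =>
    (h.lt_support_of_large hk hd hFpos hNF h1 h2 h3 hsmall σ hv).not_ge hsF
  -- The sphere just above the smaller radius has the parity of the larger one, so unless they
  -- coincide it has at most `F` points.
  obtain hpq | hpq | hpq := lt_trichotomy p q
  · have := h.eq_succ_of_large hk hpq hyd (by omega) (by omega) (F := F) fun hne => by
      have := hsmall (p + 1) q hne (by rw [Nat.even_add_one]; tauto)
      omega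
    subst this
    exact hsup p hyd hxN hyN
  · exact hy (hpq ▸ hx)
  · have := h.eq_succ_of_large hk hpq hxd (by omega) (by omega) (F := F) fun hne => by
      have := hsmall (q + 1) p hne (by rw [Nat.even_add_one]; tauto)
      omega
    subst this
    exact hsup q hxd hyN hxN

end IsBipartiteDRG
end

/-! ### The stated bound. -/

theorem mainTheorem7 {V : Type*} [Finite V] (X : SimpleGraph V) (d : ℕ)
    (hX : IsDistanceRegular X) (hbip : X.IsBipartite) (hdiam : X.diam = d) (hd : 4 ≤ d)
    (hprim : ∃ C : (distanceGraph X 2).ConnectedComponent, IsPrimitiveGraph (halvedGraph X C)) :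
    ENNReal.ofReal ((2 * (d : ℝ)) ^ (-2 * (d : ℤ) - 5) * (Nat.card V : ℝ)) ≤
      (motion X : ℝ≥0∞) := by
  classical
  have := Fintype.ofFinite V
  obtain ⟨C, hC⟩ := hprim
  obtain ⟨b, c, h⟩ := hX.exists_isBipartiteDRG hbip
  rw [hdiam] at h
  have hd4 : (4 : ℝ) ≤ d := mod_cast hd
  have hpow : (2 * (d : ℝ)) ^ (-2 * (d : ℤ) - 5) ≤ (16 * (d : ℝ) ^ 2)⁻¹ := by
    calc (2 * (d : ℝ)) ^ (-2 * (d : ℤ) - 5) ≤ (2 * (d : ℝ)) ^ (-4 : ℤ) :=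
          zpow_le_zpow_right₀ (by linarith) (by omega)
      _ = (16 * (d : ℝ) ^ 4)⁻¹ := by
          rw [zpow_neg]
          norm_cast
          rw [mul_pow]
          norm_num
      _ ≤ (16 * (d : ℝ) ^ 2)⁻¹ := by
          gcongr
          · linarith
          · norm_num
  -- Rounding up loses nothing, as support sizes are integers, and allows comparison in `ℕ∞`, where
  -- `motion X` may be `⊤`.
  have hle : ((⌈(2 * (d : ℝ)) ^ (-2 * (d : ℤ) - 5) * (Nat.card V : ℝ)⌉₊ : ℕ) : ℕ∞) ≤ motion X := by
    refine le_iInf₂ fun σ hσ => ?_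
    obtain ⟨v, hv⟩ : ∃ v, σ v ≠ v := by
      by_contra! hfix
      exact hσ (RelIso.ext hfix)
    rw [Set.encard_eq_coe_toFinset_card, Nat.cast_le, Nat.ceil_le]
    have hcard := h.card_le_support hd hC σ hv
    have hcard' : (Nat.card V : ℝ) ≤ 16 * d ^ 2 * Finset.card {w | σ w ≠ w} := by
      rw [Nat.card_eq_fintype_card]
      exact_mod_cast hcard
    calc (2 * (d : ℝ)) ^ (-2 * (d : ℤ) - 5) * (Nat.card V : ℝ)
        ≤ (16 * (d : ℝ) ^ 2)⁻¹ * (16 * d ^ 2 * Finset.card {w | σ w ≠ w}) := by gcongr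
      _ = Finset.card {w | σ w ≠ w} := by
          rw [inv_mul_cancel_left₀]
          positivity
      _ = _ := by
          congr 2
          ext w
          simp
  refine le_trans (ENNReal.ofReal_le_ofReal (Nat.le_ceil _)) ?_
  rw [ENNReal.ofReal_natCast]
  exact_mod_cast ENat.toENNReal_le.2 hle
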